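/- Let $D\subset\mathbb C$ be an open set with $D=\overline D$, and let $\Omega_D=\{\alpha+J\beta:\alpha+i\beta\in D,\ J\in\mathbb S\}\subset\mathbb H$ be its circularization, where $\mathbb S=\{J\in\mathbb H: J^2=-1\}$. A function $f:\Omega_D\to\mathbb H$ is slice regular if $f(\alpha+J\beta)=F_0(\alpha+i\beta)+JF_1(\alpha+i\beta)$ for all $\alpha+i\beta\in D$ and $J\in\mathbb S$, for a holomorphic $F=F_0+\sqrt{-1}F_1:D\to\mathbb H\otimes_{\mathbb R}\mathbb C$ with $F(\bar z)=\overline{F(z)}$; write $f=\mathcal I(F)$, and let $\mathcal I(F)\cdot\mathcal I(G)=\mathcal I(FG)$ be the slice product. For a (sufficiently smooth) slice function $f=\mathcal I(F)$ put $(\partial_s f)(x)=(2\,\mathrm{Im}\,x)^{-1}(f(x)-f(\bar x))$ for non-real $x$, and $\partial_c f=\mathcal I(\partial F/\partial z)$. For a non-real $q_0$ let $\mathbb S_{q_0}=\mathrm{Re}(q_0)+\mathbb S\,|\mathrm{Im}(q_0)|$ and $\Delta_{q_0}(x)=x^2-2\,\mathrm{Re}(q_0)x+|q_0|^2$. Multiplicities.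 Suppose that on $\Omega_D$ $$f(x)=\Delta_{q_0}^m(x)\,(x-q_1)\cdot(x-q_2)\cdots(x-q_r)\cdot g(x)$$ with $m,r\in\mathbb N$, $q_1,\dots,q_r\in\mathbb S_{q_0}$, $q_i\ne\bar q_{i+1}$ for $1\le i<r$, and $g$ slice regular on $\Omega_D$ without zeros in $\mathbb S_{q_0}$. Then $2m$ is called the spherical multiplicity of $f$ at $\mathbb S_{q_0}$, and $r$ the isolated multiplicity of $q_1$ (if $r\geq 1$); points of $\mathbb S_{q_0}$ other than $q_1$ have isolated multiplicity $0$. Corollary 4.3 (spherical multiplicity criterion). Let $f$ be slice regular on $\Omega_D$ and $q_0\in\Omega_D\setminus\mathbb R$. Assume that either $D$ is connected and $D\cap\mathbb R\neq\emptyset$, or there are points $x$ arbitrarily close to $q_0$ such that $f$ has no zero on the sphere $\mathbb S_x=\mathrm{Re}(x)+\mathbb S\,|\mathrm{Im}(x)|$. Let $n\in\mathbb N$ be such that $$((\partial_c\partial_s)^kf)(q_0)=(\partial_s(\partial_c\partial_s)^kf)(q_0)=0\quad\text{for all }0\le k<n,$$ and $((\partial_c\partial_s)^nf)(q_0)\ne0$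 or $(\partial_s(\partial_c\partial_s)^nf)(q_0)\neq0$. Then $2n$ is the spherical multiplicity of $f$ at $\mathbb S_{q_0}$: a factorization as above exists, and every such factorization has $m=n$. Moreover, $q_0$ has positive isolated multiplicity (that is, there is such a factorization with $r\ge1$ and $q_1=q_0$) if and only if $((\partial_c\partial_s)^nf)(q_0)=0$. -/

import Mathlib

open scoped Quaternion Topology

noncomputable section

namespace SliceAnalysis

/-- The set `𝕊` of imaginary units of the quaternions. -/
def imagUnits : Set ℍ[ℝ] := {J | J * J = -1}

/-- The point `α + J β` of the slice `ℂ_J` that corresponds to `z = α + i β`. -/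
def slicePoint (J : ℍ[ℝ]) (z : ℂ) : ℍ[ℝ] := (z.re : ℍ[ℝ]) + J * (z.im : ℍ[ℝ])

/-- The circularization `Ω_D = {α + J β | α + i β ∈ D, J ∈ 𝕊}` of `D ⊆ ℂ`. -/
def circularization (D : Set ℂ) : Set ℍ[ℝ] :=
  {x | ∃ z ∈ D, ∃ J ∈ imagUnits, x = slicePoint J z}

/-- The sphere `𝕊_q = Re q + 𝕊 |Im q|`. -/
def sphere (q : ℍ[ℝ]) : Set ℍ[ℝ] :=
  {x | ∃ J ∈ imagUnits, x = slicePoint J ⟨q.re, ‖q.im‖⟩}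

/-! The algebra `ℍ ⊗ ℂ = {x + √-1 y | x, y ∈ ℍ}` is realized as the algebra `ℍ[ℂ]` of quaternions
with complex coefficients, in which `√-1` is the (central) scalar `Complex.I`. -/

/-- The element `x + √-1 y` of `ℍ ⊗ ℂ`. -/
def ofParts (x y : ℍ[ℝ]) : ℍ[ℂ] :=
  ⟨⟨x.re, y.re⟩, ⟨x.imI, y.imI⟩, ⟨x.imJ, y.imJ⟩, ⟨x.imK, y.imK⟩⟩

/-- The component `x` of `x + √-1 y`. -/
def part0 (w : ℍ[ℂ]) : ℍ[ℝ] := ⟨w.re.re, w.imI.re, w.imJ.re, w.imK.re⟩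

/-- The component `y` of `x + √-1 y`. -/
def part1 (w : ℍ[ℂ]) : ℍ[ℝ] := ⟨w.re.im, w.imI.im, w.imJ.im, w.imK.im⟩

/-- `F` is a stem function on `D`: `F (conj z) = F₀ z - √-1 F₁ z` for `z ∈ D`. -/
def IsStem (D : Set ℂ) (F : ℂ → ℍ[ℂ]) : Prop :=
  ∀ z ∈ D, F (star z) = ofParts (part0 (F z)) (-part1 (F z))

/-- Holomorphy of an `ℍ ⊗ ℂ`-valued function with respect to the complex structure `√-1`. -/
def IsHolomorphicOn (F : ℂ → ℍ[ℂ]) (D : Set ℂ) : Prop :=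
  DifferentiableOn ℂ (fun z => (F z).re) D ∧ DifferentiableOn ℂ (fun z => (F z).imI) D ∧
  DifferentiableOn ℂ (fun z => (F z).imJ) D ∧ DifferentiableOn ℂ (fun z => (F z).imK) D

/-- `f` is the slice function on `Ω_D` induced by `F`:
`f (α + J β) = F₀ (α + i β) + J F₁ (α + i β)`. -/
def IsInducedBy (D : Set ℂ) (F : ℂ → ℍ[ℂ]) (f : ℍ[ℝ] → ℍ[ℝ]) : Prop :=
  ∀ z ∈ D, ∀ J ∈ imagUnits, f (slicePoint J z) = part0 (F z) + J * part1 (F z)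

/-- `f` is (left) slice regular on `Ω_D`. Only the values of `f` on `Ω_D` matter. -/
def IsSliceRegular (D : Set ℂ) (f : ℍ[ℝ] → ℍ[ℝ]) : Prop :=
  ∃ F : ℂ → ℍ[ℂ], IsStem D F ∧ IsHolomorphicOn F D ∧ IsInducedBy D F f

/-- The operator `𝓘`: the slice function induced by a stem function, evaluated by writing
`x = α + J β` with `β = |Im x|` and `J = Im x / |Im x|` (a stem function has `F₁ = 0` at real
points, so there the choice of `J` is irrelevant). -/
def induce (F : ℂ → ℍ[ℂ]) (x : ℍ[ℝ]) : ℍ[ℝ] :=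
  part0 (F ⟨x.re, ‖x.im‖⟩) + ((‖x.im‖⁻¹ : ℝ) • x.im) * part1 (F ⟨x.re, ‖x.im‖⟩)

/-- The imaginary unit `i`. -/
def unitI : ℍ[ℝ] := ⟨0, 1, 0, 0⟩

/-- The inverse of `𝓘`: the stem function of a slice function, read off on the slice `ℂ_i` of
the unit `i` (for a slice function the result does not depend on the unit). -/
def stemOf (f : ℍ[ℝ] → ℍ[ℝ]) (z : ℂ) : ℍ[ℂ] :=
  ofParts ((1 / 2 : ℝ) • (f (slicePoint unitI z) + f (slicePoint (-unitI) z)))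
    (-unitI * ((1 / 2 : ℝ) • (f (slicePoint unitI z) - f (slicePoint (-unitI) z))))

/-- `∂/∂z = (∂/∂α - √-1 ∂/∂β) / 2` on complex-valued functions. -/
def wirtinger (φ : ℂ → ℂ) (z : ℂ) : ℂ :=
  (1 / 2 : ℂ) * (fderiv ℝ φ z 1 - Complex.I * fderiv ℝ φ z Complex.I)

/-- `∂F/∂z` for `ℍ ⊗ ℂ`-valued functions. -/
def stemDeriv (F : ℂ → ℍ[ℂ]) (z : ℂ) : ℍ[ℂ] :=
  ⟨wirtinger (fun w => (F w).re) z, wirtinger (fun w => (F w).imI) z,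
    wirtinger (fun w => (F w).imJ) z, wirtinger (fun w => (F w).imK) z⟩

/-- The spherical derivative `(∂_s f)(x) = (2 Im x)⁻¹ (f x - f xᶜ)`, for non-real `x`. -/
def sphericalDeriv (f : ℍ[ℝ] → ℍ[ℝ]) (x : ℍ[ℝ]) : ℍ[ℝ] :=
  (2 * x.im)⁻¹ * (f x - f (star x))

/-- The slice derivative `∂_c f = 𝓘 (∂F/∂z)` of `f = 𝓘 F`. -/
def sliceDeriv (f : ℍ[ℝ] → ℍ[ℝ]) : ℍ[ℝ] → ℍ[ℝ] := induce (stemDeriv (stemOf f))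

/-- The iterated operator `(∂_c ∂_s)^k`. -/
def csDeriv (k : ℕ) (f : ℍ[ℝ] → ℍ[ℝ]) : ℍ[ℝ] → ℍ[ℝ] :=
  (fun h => sliceDeriv (sphericalDeriv h))^[k] f

/-- The slice product `𝓘 F · 𝓘 G = 𝓘 (F G)`. -/
def sliceMul (f g : ℍ[ℝ] → ℍ[ℝ]) : ℍ[ℝ] → ℍ[ℝ] := induce (fun z => stemOf f z * stemOf g z)

/-- The characteristic polynomial `Δ_q (x) = x² - x (q + qᶜ) + q qᶜ`. -/
def charPoly (q x : ℍ[ℝ]) : ℍ[ℝ] := x ^ 2 - x * (q + star q) + q * star q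

/-- The slice product `(x - q₁) · (x - q₂) · … · (x - qᵣ) · g`. -/
def linearFactors (qs : List ℍ[ℝ]) (g : ℍ[ℝ] → ℍ[ℝ]) : ℍ[ℝ] → ℍ[ℝ] :=
  qs.foldr (fun q h => sliceMul (fun x => x - q) h) g

/-- `f = Δ_q^m (x - q₁) · … · (x - qᵣ) · g` on `Ω_D`, with `q₁, …, qᵣ ∈ 𝕊_q`, no `qᵢ` the conjugate
of `qᵢ₊₁`, and `g` slice regular on `Ω_D` without zeros in `𝕊_q`.
(As `Δ_q^m` is slice preserving, its slice product with a function is the pointwise one.) -/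
def HasFactorization (D : Set ℂ) (f : ℍ[ℝ] → ℍ[ℝ]) (q : ℍ[ℝ]) (m : ℕ) (qs : List ℍ[ℝ]) : Prop :=
  (∀ p ∈ qs, p ∈ sphere q) ∧ qs.IsChain (fun a b => a ≠ star b) ∧
  ∃ g : ℍ[ℝ] → ℍ[ℝ], IsSliceRegular D g ∧ (∀ x ∈ sphere q, g x ≠ 0) ∧
    ∀ x ∈ circularization D, f x = charPoly q x ^ m * linearFactors qs g x

/-- `N` is a spherical multiplicity of `f` at `𝕊_q`. -/
def IsSphericalMultiplicity (D : Set ℂ) (f : ℍ[ℝ] → ℍ[ℝ]) (q : ℍ[ℝ]) (N : ℕ) : Prop :=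
  ∃ m qs, HasFactorization D f q m qs ∧ N = 2 * m

/-- `r` is an isolated multiplicity of `q` for `f`: the number of linear factors if the first of
them is `x - q`, and `0` if `x - q` is not the first linear factor. -/
def IsIsolatedMultiplicity (D : Set ℂ) (f : ℍ[ℝ] → ℍ[ℝ]) (q : ℍ[ℝ]) (r : ℕ) : Prop :=
  ∃ m qs, HasFactorization D f q m qs ∧
    ((qs.head? = some q ∧ r = qs.length) ∨ (qs.head? ≠ some q ∧ r = 0))

end SliceAnalysis

end

/-! Off the real axis a holomorphic stem function `F = F₀ + √-1 F₁` satisfies the Cauchy-Riemann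
equations, and by them `∂_c ∂_s` acts on the parts `F₀` and `F₁ / β` of `F (α + i β)` as
`-(2β)⁻¹ ∂/∂β = -∂/∂(β²)`. Along the vertical line through `z₀ = α₀ + i β₀` the stem function of
`Δ_{q₀}` is `β₀² - β²`, so if `F = Δ_{q₀}^m P` near `z₀`, then all the derivatives of order less
than `m` vanish at `q₀` and those of order `m` are `m!` times the parts of `P z₀`. For
`P = (x - q₁) ⋯ (x - qᵣ) · g` these parts do not both vanish, which gives `m = n`, and the value of
`P` at `q₀` is zero exactly when `r ≥ 1` and `q₁ = q₀`.

A factorization exists by division: the quaternionic norm `|F₀|² - |F₁|² + 2 √-1 ⟨F₀, F₁⟩` of `F`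
is a holomorphic function that vanishes at `z₀` exactly if `f` has a zero on the sphere of `q₀`.
Its order at `z₀` drops with each factor `Δ_{q₀}` or `x - q` split off, and it is finite by the
nondegeneracy assumption. -/

noncomputable section

namespace SliceAnalysis

lemma norm_eq_one_of_mem_imagUnits {J : ℍ[ℝ]} (hJ : J ∈ imagUnits) : ‖J‖ = 1 := by
  have h : ‖J‖ * ‖J‖ = 1 := by
    rw [← norm_mul, show J * J = -1 from hJ, norm_neg, norm_one]
  nlinarith [norm_nonneg J]

lemma mem_imagUnits_iff {J : ℍ[ℝ]} : J ∈ imagUnits ↔ J.re = 0 ∧ ‖J‖ = 1 := by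
  have key (h : ‖J‖ = 1) : J ∈ imagUnits ↔ J.re = 0 := by
    rw [← Quaternion.sq_eq_neg_normSq, Quaternion.normSq_eq_norm_mul_self, h, mul_one,
      Quaternion.coe_one, sq]
    rfl
  exact ⟨fun hJ => have h := norm_eq_one_of_mem_imagUnits hJ; ⟨(key h).1 hJ, h⟩,
    fun h => (key h.2).2 h.1⟩

lemma star_eq_neg_of_mem_imagUnits {J : ℍ[ℝ]} (hJ : J ∈ imagUnits) : star J = -J :=
  Quaternion.star_eq_neg.2 (mem_imagUnits_iff.1 hJ).1

lemma neg_mem_imagUnits {J : ℍ[ℝ]} (hJ : J ∈ imagUnits) : -J ∈ imagUnits :=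
  (neg_mul_neg J J).trans hJ

lemma unitI_mem_imagUnits : unitI ∈ imagUnits := by
  change unitI * unitI = -1
  ext <;> simp only [Quaternion.re_mul, Quaternion.imI_mul, Quaternion.imJ_mul,
    Quaternion.imK_mul] <;> simp [unitI]

lemma mul_mul_of_mem_imagUnits {J : ℍ[ℝ]} (hJ : J ∈ imagUnits) (x : ℍ[ℝ]) :
    J * (J * x) = -x := by
  rw [← mul_assoc, show J * J = -1 from hJ, neg_one_mul]

lemma slicePoint_eq (J : ℍ[ℝ]) (z : ℂ) : slicePoint J z = (z.re : ℍ[ℝ]) + z.im • J := by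
  rw [slicePoint, Quaternion.mul_coe_eq_smul]

lemma slicePoint_eq_lift {J : ℍ[ℝ]} (hJ : J ∈ imagUnits) (z : ℂ) :
    slicePoint J z = Complex.lift ⟨J, hJ⟩ z := by
  rw [slicePoint_eq]
  rfl

lemma slicePoint_star (J : ℍ[ℝ]) (z : ℂ) : slicePoint J (star z) = slicePoint (-J) z := by
  simp [slicePoint]

lemma star_slicePoint {J : ℍ[ℝ]} (hJ : J ∈ imagUnits) (z : ℂ) :
    star (slicePoint J z) = slicePoint (-J) z := by
  simp [slicePoint_eq, star_eq_neg_of_mem_imagUnits hJ]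

lemma re_slicePoint {J : ℍ[ℝ]} (hJ : J ∈ imagUnits) (z : ℂ) : (slicePoint J z).re = z.re := by
  simp [slicePoint_eq, (mem_imagUnits_iff.1 hJ).1]

lemma im_slicePoint {J : ℍ[ℝ]} (hJ : J ∈ imagUnits) (z : ℂ) :
    (slicePoint J z).im = z.im • J := by
  ext <;> simp [slicePoint_eq, (mem_imagUnits_iff.1 hJ).1]

lemma norm_im_slicePoint {J : ℍ[ℝ]} (hJ : J ∈ imagUnits) (z : ℂ) :
    ‖(slicePoint J z).im‖ = |z.im| := by
  rw [im_slicePoint hJ, norm_smul, norm_eq_one_of_mem_imagUnits hJ, mul_one, Real.norm_eq_abs]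

/-- The point `Re q + i |Im q|` of the complex plane. -/
def planePoint (q : ℍ[ℝ]) : ℂ := ⟨q.re, ‖q.im‖⟩

lemma planePoint_slicePoint {J : ℍ[ℝ]} (hJ : J ∈ imagUnits) {z : ℂ} (hz : 0 ≤ z.im) :
    planePoint (slicePoint J z) = z :=
  Complex.ext (re_slicePoint hJ z) ((norm_im_slicePoint hJ z).trans (abs_of_nonneg hz))

lemma continuous_planePoint : Continuous planePoint :=
  Complex.equivRealProdCLM.symm.continuous.comp
    (Quaternion.continuous_re.prodMk Quaternion.continuous_im.norm)

lemma exists_eq_slicePoint_planePoint {q : ℍ[ℝ]} (hq : q.im ≠ 0) :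
    ∃ J ∈ imagUnits, q = slicePoint J (planePoint q) := by
  have hn : ‖q.im‖ ≠ 0 := norm_ne_zero_iff.2 hq
  refine ⟨‖q.im‖⁻¹ • q.im, mem_imagUnits_iff.2 ⟨by simp, by simp [norm_smul, hn]⟩, ?_⟩
  rw [slicePoint_eq, planePoint, smul_inv_smul₀ hn, Quaternion.re_add_im]

lemma planePoint_mem {D : Set ℂ} (hsymm : ∀ z ∈ D, star z ∈ D) {q : ℍ[ℝ]}
    (hq : q ∈ circularization D) : planePoint q ∈ D := by
  obtain ⟨z, hz, J, hJ, rfl⟩ := hq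
  rcases le_total 0 z.im with h | h
  · rwa [planePoint_slicePoint hJ h]
  · rw [← neg_neg J, ← slicePoint_star,
      planePoint_slicePoint (neg_mem_imagUnits hJ) (by simpa using h)]
    exact hsymm z hz

/-- The stem function `(z - z₀) (z - conj z₀)` of a characteristic polynomial. -/
def quad (z₀ z : ℂ) : ℂ := (z - z₀) * (z - star z₀)

@[simp] lemma quad_self (z : ℂ) : quad z z = 0 := by simp [quad]

lemma star_quad (z₀ z : ℂ) : star (quad z₀ z) = quad z₀ (star z) := by
  simp [quad, mul_comm]

lemma quad_vertical (z₀ : ℂ) (t : ℝ) :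
    quad z₀ ⟨z₀.re, t⟩ = ((z₀.im ^ 2 - t ^ 2 : ℝ) : ℂ) := by
  apply Complex.ext
  · rw [Complex.ofReal_re]; simp [quad]; ring
  · rw [Complex.ofReal_im]; simp [quad]

lemma normSq_eq_re_sq_add_norm_im_sq (q : ℍ[ℝ]) :
    Quaternion.normSq q = q.re ^ 2 + ‖q.im‖ ^ 2 := by
  rw [sq ‖q.im‖, ← Quaternion.normSq_eq_norm_mul_self]
  simp only [Quaternion.normSq_def', Quaternion.re_im, Quaternion.imI_im, Quaternion.imJ_im,
    Quaternion.imK_im]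
  ring

lemma quad_planePoint (q : ℍ[ℝ]) (z : ℂ) :
    quad (planePoint q) z = z ^ 2 - z * ((2 * q.re : ℝ) : ℂ) + (Quaternion.normSq q : ℝ) := by
  rw [normSq_eq_re_sq_add_norm_im_sq]
  apply Complex.ext <;> simp [quad, planePoint, sq] <;> ring

lemma charPoly_slicePoint {J : ℍ[ℝ]} (hJ : J ∈ imagUnits) (q : ℍ[ℝ]) (z : ℂ) :
    charPoly q (slicePoint J z) = slicePoint J (quad (planePoint q) z) := by
  have hcoe (r : ℝ) : Complex.lift ⟨J, hJ⟩ (r : ℂ) = (r : ℍ[ℝ]) :=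
    (Complex.lift ⟨J, hJ⟩).commutes r
  rw [charPoly, Quaternion.self_add_star', Quaternion.self_mul_star, slicePoint_eq_lift hJ,
    slicePoint_eq_lift hJ, quad_planePoint, map_add, map_sub, map_mul, map_pow, hcoe, hcoe]

attribute [simps] part0 part1 ofParts

/-- The complex coordinates on `ℍ ⊗ ℂ`; they carry the topology of `ℂ⁴` over to it. -/
def coords : ℍ[ℂ] ≃ₗ[ℂ] (Fin 4 → ℂ) where
  toFun w := ![w.re, w.imI, w.imJ, w.imK]
  invFun v := ⟨v 0, v 1, v 2, v 3⟩
  map_add' _ _ := by ext i; fin_cases i <;> rfl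
  map_smul' _ _ := by ext i; fin_cases i <;> rfl
  left_inv _ := rfl
  right_inv _ := by ext i; fin_cases i <;> rfl

instance : NormedAddCommGroup ℍ[ℂ] := .induced ℍ[ℂ] (Fin 4 → ℂ) coords coords.injective

instance : NormedSpace ℂ ℍ[ℂ] := .induced ℂ ℍ[ℂ] (Fin 4 → ℂ) coords

instance : NormedSpace ℝ ℍ[ℂ] := .induced ℝ ℍ[ℂ] (Fin 4 → ℂ) (coords.restrictScalars ℝ)

instance : SMulCommClass ℂ ℍ[ℂ] ℍ[ℂ] :=
  inferInstanceAs (SMulCommClass ℂ ℍ[ℂ,-1,0,-1] ℍ[ℂ,-1,0,-1])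

instance : FiniteDimensional ℝ ℍ[ℂ] := (coords.restrictScalars ℝ).symm.finiteDimensional

@[simp] lemma part0_ofParts (x y : ℍ[ℝ]) : part0 (ofParts x y) = x := rfl

@[simp] lemma part1_ofParts (x y : ℍ[ℝ]) : part1 (ofParts x y) = y := rfl

lemma ext_part {w v : ℍ[ℂ]} (h0 : part0 w = part0 v) (h1 : part1 w = part1 v) : w = v := by
  rw [show w = ofParts (part0 w) (part1 w) from rfl, h0, h1]
  rfl

/-- The decomposition `ℍ ⊗ ℂ = ℍ ⊕ √-1 ℍ`. -/
def parts : ℍ[ℂ] ≃L[ℝ] ℍ[ℝ] × ℍ[ℝ] :=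
  LinearEquiv.toContinuousLinearEquiv
    { toFun := fun w => (part0 w, part1 w)
      invFun := fun p => ofParts p.1 p.2
      map_add' := fun _ _ => rfl
      map_smul' := fun _ _ => Prod.ext (by ext <;> simp) (by ext <;> simp)
      left_inv := fun _ => rfl
      right_inv := fun _ => rfl }

@[simp] lemma part0_zero : part0 0 = 0 := rfl

@[simp] lemma part1_zero : part1 0 = 0 := rfl

lemma part0_mul (w v : ℍ[ℂ]) :
    part0 (w * v) = part0 w * part0 v - part1 w * part1 v := by
  ext <;> simp <;> ring

lemma part1_mul (w v : ℍ[ℂ]) :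
    part1 (w * v) = part0 w * part1 v + part1 w * part0 v := by
  ext <;> simp <;> ring

lemma part0_smul (c : ℂ) (w : ℍ[ℂ]) : part0 (c • w) = c.re • part0 w - c.im • part1 w := by
  ext <;> simp

lemma part1_smul (c : ℂ) (w : ℍ[ℂ]) : part1 (c • w) = c.re • part1 w + c.im • part0 w := by
  ext <;> simp

/-- The value `x + J y` at `J` of the slice function with stem `x + √-1 y`. -/
def evalAt (J : ℍ[ℝ]) (w : ℍ[ℂ]) : ℍ[ℝ] := part0 w + J * part1 w

@[simp] lemma evalAt_zero (J : ℍ[ℝ]) : evalAt J 0 = 0 := by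
  simp [evalAt]

lemma evalAt_smul {J : ℍ[ℝ]} (hJ : J ∈ imagUnits) (c : ℂ) (w : ℍ[ℂ]) :
    evalAt J (c • w) = slicePoint J c * evalAt J w := by
  simp only [evalAt, part0_smul, part1_smul, slicePoint_eq, add_mul, mul_add, smul_mul_assoc,
    mul_smul_comm, Quaternion.coe_mul_eq_smul, mul_mul_of_mem_imagUnits hJ, smul_neg]
  abel

lemma evalAt_injective_pair {w v : ℍ[ℂ]} {J K : ℍ[ℝ]} (hne : J ≠ K)
    (hJ : evalAt J w = evalAt J v) (hK : evalAt K w = evalAt K v) : w = v := by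
  have h : (J - K) * (part1 w - part1 v) = 0 :=
    calc (J - K) * (part1 w - part1 v)
        = (evalAt J w - evalAt J v) - (evalAt K w - evalAt K v) := by
          simp only [evalAt, sub_mul, mul_sub]; abel
      _ = 0 := by rw [hJ, hK, sub_self, sub_self, sub_self]
  have h1 : part1 w = part1 v :=
    sub_eq_zero.1 ((mul_eq_zero.1 h).resolve_left (sub_ne_zero.2 hne))
  exact ext_part (by simpa [evalAt, h1] using hJ) h1

lemma ext_evalAt {w v : ℍ[ℂ]} (h : ∀ J ∈ imagUnits, evalAt J w = evalAt J v) : w = v := by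
  have hne : unitI ≠ -unitI := by
    intro h
    have himI : unitI.imI = -unitI.imI := congrArg QuaternionAlgebra.imI h
    norm_num [unitI] at himI
  exact evalAt_injective_pair hne (h _ unitI_mem_imagUnits)
    (h _ (neg_mem_imagUnits unitI_mem_imagUnits))

/-- The conjugation `x + √-1 y ↦ x - √-1 y` of `ℍ ⊗ ℂ`, under which stem functions are
equivariant. It conjugates the scalars and is not the quaternionic `star`. -/
def stemConj (w : ℍ[ℂ]) : ℍ[ℂ] := ofParts (part0 w) (-part1 w)

lemma continuous_stemConj : Continuous stemConj := by
  have h := parts.continuous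
  exact parts.symm.continuous.comp (h.fst.prodMk h.snd.neg)

lemma stemConj_mul (w v : ℍ[ℂ]) : stemConj (w * v) = stemConj w * stemConj v := by
  apply ext_part <;> simp only [stemConj, part0_mul, part1_mul, part0_ofParts, part1_ofParts,
    mul_neg, neg_mul, neg_neg, neg_add]

lemma stemConj_smul (c : ℂ) (w : ℍ[ℂ]) : stemConj (c • w) = star c • stemConj w := by
  apply ext_part <;> simp only [stemConj, part0_smul, part1_smul, part0_ofParts, part1_ofParts,
    Complex.star_def, Complex.conj_re, Complex.conj_im, smul_neg, neg_smul, neg_neg, neg_add]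

lemma normSq_eq (w : ℍ[ℂ]) :
    Quaternion.normSq w = ⟨Quaternion.normSq (part0 w) - Quaternion.normSq (part1 w),
      2 * (part0 w * star (part1 w)).re⟩ := by
  simp only [Quaternion.normSq_def']
  apply Complex.ext <;> simp [sq] <;> ring

lemma exists_evalAt_eq_zero {w : ℍ[ℂ]} (hw : Quaternion.normSq w = 0) :
    ∃ J ∈ imagUnits, evalAt J w = 0 := by
  rw [normSq_eq, Complex.ext_iff] at hw
  obtain ⟨hnorm, horth⟩ := hw
  have hnorm' : ‖part0 w‖ = ‖part1 w‖ := by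
    simpa [Quaternion.normSq_eq_norm_mul_self, sub_eq_zero, mul_self_inj] using hnorm
  by_cases h1 : part1 w = 0
  · have h0 : part0 w = 0 := by simpa [h1] using hnorm'
    exact ⟨unitI, unitI_mem_imagUnits, by simp [evalAt, h0, h1]⟩
  · refine ⟨-(part0 w * (part1 w)⁻¹), mem_imagUnits_iff.2 ⟨?_, ?_⟩, ?_⟩
    · have hre : (part0 w * star (part1 w)).re = 0 := by simpa using horth
      rw [Quaternion.inv_def, mul_smul_comm, ← smul_neg, Quaternion.re_smul, Quaternion.re_neg,
        hre, neg_zero, smul_zero]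
    · rw [norm_neg, norm_mul, norm_inv, hnorm', mul_inv_cancel₀ (norm_ne_zero_iff.2 h1)]
    · rw [evalAt, neg_mul, inv_mul_cancel_right₀ h1, add_neg_cancel]

/-- The stem function `z - q`. -/
def linStem (q : ℍ[ℝ]) (z : ℂ) : ℍ[ℂ] := ofParts ((z.re : ℍ[ℝ]) - q) (z.im : ℍ[ℝ])

lemma linStem_star (q : ℍ[ℝ]) (z : ℂ) : linStem (star q) z = star (linStem q z) := by
  ext <;> apply Complex.ext <;> simp [linStem]

lemma normSq_linStem (q : ℍ[ℝ]) (z : ℂ) :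
    Quaternion.normSq (linStem q z) = quad (planePoint q) z := by
  rw [normSq_eq, quad_planePoint]
  apply Complex.ext <;> simp [linStem, Quaternion.normSq_def', sq] <;> ring

lemma linStem_mul_linStem_star (q : ℍ[ℝ]) (z : ℂ) (w : ℍ[ℂ]) :
    linStem q z * (linStem (star q) z * w) = quad (planePoint q) z • w := by
  rw [linStem_star, ← mul_assoc, Quaternion.self_mul_star, normSq_linStem,
    Quaternion.coe_mul_eq_smul]

lemma linStem_star_mul_linStem (q : ℍ[ℝ]) (z : ℂ) (w : ℍ[ℂ]) :
    linStem (star q) z * (linStem q z * w) = quad (planePoint q) z • w := by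
  rw [linStem_star, ← mul_assoc, Quaternion.star_mul_self, normSq_linStem,
    Quaternion.coe_mul_eq_smul]

lemma linStem_star_mul_eq_zero_iff {J : ℍ[ℝ]} (hJ : J ∈ imagUnits) {z : ℂ} (hz : z.im ≠ 0)
    {w : ℍ[ℂ]} : linStem (star (slicePoint J z)) z * w = 0 ↔ evalAt J w = 0 := by
  have h : linStem (star (slicePoint J z)) z * w
      = ofParts (z.im • (J * evalAt J w)) (z.im • evalAt J w) := by
    have h0 : part0 (linStem (star (slicePoint J z)) z) = z.im • J := by
      rw [star_slicePoint hJ, linStem, part0_ofParts, slicePoint_eq]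
      module
    have h1 : part1 (linStem (star (slicePoint J z)) z) = z.im := rfl
    apply ext_part
    · simp [part0_mul, h0, h1, evalAt, mul_add, mul_mul_of_mem_imagUnits hJ,
        Quaternion.coe_mul_eq_smul, sub_eq_add_neg]
    · simp [part1_mul, h0, h1, evalAt, Quaternion.coe_mul_eq_smul, add_comm]
  rw [h]
  refine ⟨fun h0 => ?_, fun h0 => by rw [h0, mul_zero, smul_zero]; rfl⟩
  simpa [hz] using congrArg part1 h0

/-- The stem function of `(x - q₁) · … · (x - qᵣ)`. -/
def linProd (qs : List ℍ[ℝ]) (z : ℂ) : ℍ[ℂ] := (qs.map fun q => linStem q z).prod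

@[simp] lemma linProd_nil (z : ℂ) : linProd [] z = 1 := rfl

lemma linProd_cons_mul (q : ℍ[ℝ]) (qs : List ℍ[ℝ]) (z : ℂ) (w : ℍ[ℂ]) :
    linProd (q :: qs) z * w = linStem q z * (linProd qs z * w) := by
  simp [linProd, mul_assoc]

lemma evalAt_linStem_mul {J : ℍ[ℝ]} (hJ : J ∈ imagUnits) {z : ℂ} (hz : 0 < z.im) (w : ℍ[ℂ]) :
    evalAt J (linStem (slicePoint J z) z * w) = 0 := by
  rw [← linStem_star_mul_eq_zero_iff hJ hz.ne', linStem_star_mul_linStem,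
    planePoint_slicePoint hJ hz.le, quad_self, zero_smul ℂ]

lemma linProd_mul_ne_zero_and_evalAt_eq_zero_iff {z : ℂ} (hz : 0 < z.im) {w : ℍ[ℂ]}
    (hw : ∀ J ∈ imagUnits, evalAt J w ≠ 0) {qs : List ℍ[ℝ]}
    (hqs : ∀ p ∈ qs, ∃ J ∈ imagUnits, p = slicePoint J z)
    (hc : qs.IsChain fun a b => a ≠ star b) :
    linProd qs z * w ≠ 0 ∧
      ∀ J ∈ imagUnits, evalAt J (linProd qs z * w) = 0 ↔ qs.head? = some (slicePoint J z) := by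
  induction qs with
  | nil =>
    rw [linProd_nil, one_mul]
    exact ⟨fun h => hw _ unitI_mem_imagUnits (by rw [h, evalAt_zero]),
      fun J hJ => by simp [hw J hJ]⟩
  | cons q qs ih =>
    obtain ⟨-, hzero⟩ := ih (fun p hp => hqs p (List.mem_cons_of_mem _ hp)) hc.tail
    obtain ⟨J, hJ, rfl⟩ := hqs q List.mem_cons_self
    have hJ' := neg_mem_imagUnits hJ
    have hstar : slicePoint J z = star (slicePoint (-J) z) := by rw [star_slicePoint hJ', neg_neg]
    rw [linProd_cons_mul]
    have hne : linStem (slicePoint J z) z * (linProd qs z * w) ≠ 0 := by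
      rw [hstar, ne_eq, linStem_star_mul_eq_zero_iff hJ' hz.ne', hzero _ hJ']
      intro h
      obtain ⟨ps, rfl⟩ := List.head?_eq_some_iff.1 h
      exact (List.isChain_cons_cons.1 hc).1 hstar
    refine ⟨hne, fun K hK => ?_⟩
    rw [List.head?_cons, Option.some.injEq]
    refine ⟨fun h => ?_, fun h => ?_⟩
    · by_contra hJK
      exact hne (evalAt_injective_pair (fun e : J = K => hJK (by rw [e]))
        (by rw [evalAt_linStem_mul hJ hz, evalAt_zero]) (by rw [h, evalAt_zero]))
    · rw [h, evalAt_linStem_mul hK hz]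

lemma isHolomorphicOn_iff_differentiableOn {D : Set ℂ} {F : ℂ → ℍ[ℂ]} :
    IsHolomorphicOn F D ↔ DifferentiableOn ℂ F D := by
  rw [← coords.toContinuousLinearEquiv.comp_differentiableOn_iff, differentiableOn_pi]
  simp only [Fin.forall_fin_succ, IsEmpty.forall_iff, and_true]
  exact Iff.rfl

lemma IsHolomorphicOn.mul {D : Set ℂ} {F G : ℂ → ℍ[ℂ]} (hF : IsHolomorphicOn F D)
    (hG : IsHolomorphicOn G D) : IsHolomorphicOn (fun z => F z * G z) D := by
  obtain ⟨_, _, _, _⟩ := hF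
  obtain ⟨_, _, _, _⟩ := hG
  refine ⟨?_, ?_, ?_, ?_⟩ <;>
  simp only [Quaternion.re_mul, Quaternion.imI_mul, Quaternion.imJ_mul, Quaternion.imK_mul] <;>
  fun_prop

lemma IsHolomorphicOn.normSq {D : Set ℂ} {F : ℂ → ℍ[ℂ]} (hF : IsHolomorphicOn F D) :
    DifferentiableOn ℂ (fun z => Quaternion.normSq (F z)) D := by
  obtain ⟨_, _, _, _⟩ := hF
  simp only [Quaternion.normSq_def']
  fun_prop

/-- Holomorphic stem functions, the stem functions of slice regular functions. -/
def IsRegularStem (D : Set ℂ) (F : ℂ → ℍ[ℂ]) : Prop := IsStem D F ∧ IsHolomorphicOn F D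

section Regular

variable {D : Set ℂ} {F G : ℂ → ℍ[ℂ]}

lemma IsRegularStem.differentiableOn (hF : IsRegularStem D F) : DifferentiableOn ℂ F D :=
  isHolomorphicOn_iff_differentiableOn.1 hF.2

lemma IsRegularStem.mul (hF : IsRegularStem D F) (hG : IsRegularStem D G) :
    IsRegularStem D fun z => F z * G z := by
  refine ⟨fun z hz => ?_, hF.2.mul hG.2⟩
  simp only [hF.1 z hz, hG.1 z hz]
  exact (stemConj_mul _ _).symm

lemma isRegularStem_linStem (D : Set ℂ) (q : ℍ[ℝ]) : IsRegularStem D (linStem q) := by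
  refine ⟨fun z _ => by simp [linStem], isHolomorphicOn_iff_differentiableOn.2 ?_⟩
  have h (z : ℂ) : linStem q z = z • 1 - ofParts q 0 := by
    apply ext_part <;> ext <;> simp [linStem]
  simp only [funext h]
  fun_prop

lemma IsRegularStem.linProd_mul (hG : IsRegularStem D G) (qs : List ℍ[ℝ]) :
    IsRegularStem D fun z => linProd qs z * G z := by
  induction qs with
  | nil => simpa only [linProd_nil, one_mul] using hG
  | cons q qs ih =>
    simp only [linProd_cons_mul]
    exact (isRegularStem_linStem D q).mul ih

end Regular

section Division

variable {E : Type*} [NormedAddCommGroup E] [NormedSpace ℂ E] {D : Set ℂ}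

lemma eventually_quad_ne_zero (z₀ z : ℂ) : ∀ᶠ w in 𝓝[≠] z, quad z₀ w ≠ 0 := by
  have hroot (a : ℂ) : ∀ᶠ w in 𝓝[≠] z, w - a ≠ 0 :=
    ((Filter.eventually_cofinite_ne a).filter_mono (nhdsNE_le_cofinite z)).mono
      fun _ => sub_ne_zero.2
  filter_upwards [hroot z₀, hroot (star z₀)] with w h1 h2 using mul_ne_zero h1 h2

lemma eqOn_of_quad_smul_eqOn (hD : IsOpen D) {z₀ : ℂ} {φ ψ : ℂ → E} (hφ : ContinuousOn φ D)
    (hψ : ContinuousOn ψ D) (h : ∀ z ∈ D, quad z₀ z • φ z = quad z₀ z • ψ z) :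
    Set.EqOn φ ψ D := by
  intro z hz
  have hDz := hD.mem_nhds hz
  refine ((ContinuousAt.eventuallyEq_nhds_iff_eventuallyEq_nhdsNE
    (hφ.continuousAt hDz) (hψ.continuousAt hDz)).1 ?_).eq_of_nhds
  filter_upwards [eventually_quad_ne_zero z₀ z, mem_nhdsWithin_of_mem_nhds hDz] with w hw hwD
  exact smul_right_injective E hw (h w hwD)

lemma exists_eq_sub_mul_sub_smul [CompleteSpace E] (hD : IsOpen D) {a b : ℂ} (ha : a ∈ D)
    (hb : b ∈ D) (hab : a ≠ b) {φ : ℂ → E} (hφ : DifferentiableOn ℂ φ D) (hφa : φ a = 0)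
    (hφb : φ b = 0) :
    ∃ ψ : ℂ → E, DifferentiableOn ℂ ψ D ∧ ∀ z, φ z = ((z - a) * (z - b)) • ψ z := by
  have hslope (z : ℂ) : φ z = (z - a) • dslope φ a z := by
    rw [sub_smul_dslope, hφa, sub_zero]
  have hslope_b : dslope φ a b = 0 :=
    (smul_eq_zero.1 ((hslope b).symm.trans hφb)).resolve_left (sub_ne_zero.2 hab.symm)
  refine ⟨dslope (dslope φ a) b, (Complex.differentiableOn_dslope (hD.mem_nhds hb)).2
    ((Complex.differentiableOn_dslope (hD.mem_nhds ha)).2 hφ), fun z => ?_⟩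
  rw [mul_smul, sub_smul_dslope, hslope_b, sub_zero, ← hslope]

lemma analyticOrderAt_lt_of_eventuallyEq_mul {𝕜 : Type*} [NontriviallyNormedField 𝕜]
    {χ φ ψ : 𝕜 → 𝕜} {z : 𝕜} (hχ : AnalyticAt 𝕜 χ z) (hχz : χ z = 0) (hψ : AnalyticAt 𝕜 ψ z)
    (h : φ =ᶠ[𝓝 z] χ * ψ) (hφ : analyticOrderAt φ z ≠ ⊤) :
    analyticOrderAt ψ z < analyticOrderAt φ z := by
  rw [analyticOrderAt_congr h, analyticOrderAt_mul hχ hψ] at hφ ⊢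
  exact ENat.lt_add_left (fun hT => hφ (by rw [hT, add_top]))
    (pos_iff_ne_zero.2 (hχ.analyticOrderAt_ne_zero.2 hχz))

end Division

section Factorization

variable {D : Set ℂ} {z₀ : ℂ} {F : ℂ → ℍ[ℂ]}

lemma IsRegularStem.exists_eq_quad_smul (hF : IsRegularStem D F) (hD : IsOpen D)
    (hsymm : ∀ z ∈ D, star z ∈ D) (hz₀ : z₀ ∈ D) (him : z₀.im ≠ 0) (h0 : F z₀ = 0) :
    ∃ H, IsRegularStem D H ∧ ∀ z ∈ D, F z = quad z₀ z • H z := by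
  have hne : z₀ ≠ star z₀ := fun h => him (Complex.conj_eq_iff_im.1 h.symm)
  have h0' : F (star z₀) = 0 := by rw [hF.1 z₀ hz₀, h0]; exact ext_part rfl neg_zero
  obtain ⟨H, hH, hFH⟩ := exists_eq_sub_mul_sub_smul hD hz₀ (hsymm z₀ hz₀) hne
    hF.differentiableOn h0 h0'
  refine ⟨H, ⟨fun z hz => ?_, isHolomorphicOn_iff_differentiableOn.2 hH⟩, fun z _ => hFH z⟩
  have hstem : Set.EqOn (fun z => stemConj (H (star z))) H D := by
    refine eqOn_of_quad_smul_eqOn hD (z₀ := z₀) (continuous_stemConj.comp_continuousOn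
      (hH.continuousOn.comp continuous_star.continuousOn hsymm)) hH.continuousOn fun z hz => ?_
    calc quad z₀ z • stemConj (H (star z))
        = stemConj (quad z₀ (star z) • H (star z)) := by
          rw [stemConj_smul, star_quad, star_star]
      _ = stemConj (F (star z)) := by rw [hFH (star z), quad]
      _ = F z := by rw [← star_star z, hF.1 _ (hsymm z hz), star_star, stemConj]
      _ = quad z₀ z • H z := hFH z
  refine (hstem (hsymm z hz)).symm.trans ?_
  simp only [star_star, stemConj]

lemma IsRegularStem.exists_eq_linStem_mul (hF : IsRegularStem D F) (hD : IsOpen D)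
    (hsymm : ∀ z ∈ D, star z ∈ D) (hz₀ : z₀ ∈ D) (him : 0 < z₀.im) {J : ℍ[ℝ]}
    (hJ : J ∈ imagUnits) (h0 : evalAt J (F z₀) = 0) :
    ∃ H, IsRegularStem D H ∧ ∀ z ∈ D, F z = linStem (slicePoint J z₀) z * H z := by
  set q := slicePoint J z₀
  have hpq : planePoint q = z₀ := planePoint_slicePoint hJ him.le
  obtain ⟨H, hH, hFH⟩ := ((isRegularStem_linStem D (star q)).mul hF).exists_eq_quad_smul hD
    hsymm hz₀ him.ne' ((linStem_star_mul_eq_zero_iff hJ him.ne').2 h0)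
  have hqH := (isRegularStem_linStem D q).mul hH
  refine ⟨H, hH, eqOn_of_quad_smul_eqOn (z₀ := z₀) hD hF.differentiableOn.continuousOn
    hqH.differentiableOn.continuousOn fun z hz => ?_⟩
  rw [← mul_smul_comm, ← hFH z hz, linStem_mul_linStem_star, hpq]

/-- The factorization `F = Δ^m (z - q₁) ⋯ (z - qᵣ) G` on `D`, with `Δ = (z - z₀) (z - conj z₀)`, of
which `HasFactorization` is the counterpart for slice functions. -/
def HasStemFactorization (D : Set ℂ) (F : ℂ → ℍ[ℂ]) (z₀ : ℂ) (m : ℕ) (qs : List ℍ[ℝ]) : Prop :=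
  (∀ p ∈ qs, ∃ J ∈ imagUnits, p = slicePoint J z₀) ∧ qs.IsChain (fun a b => a ≠ star b) ∧
  ∃ G, IsRegularStem D G ∧ (∀ J ∈ imagUnits, evalAt J (G z₀) ≠ 0) ∧
    ∀ z ∈ D, F z = quad z₀ z ^ m • (linProd qs z * G z)

lemma HasStemFactorization.quad_smul {H : ℂ → ℍ[ℂ]} {m : ℕ} {qs : List ℍ[ℝ]}
    (hH : HasStemFactorization D H z₀ m qs) (hFH : ∀ z ∈ D, F z = quad z₀ z • H z) :
    HasStemFactorization D F z₀ (m + 1) qs := by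
  obtain ⟨hqs, hc, G, hG, hG0, hHG⟩ := hH
  refine ⟨hqs, hc, G, hG, hG0, fun z hz => ?_⟩
  rw [hFH z hz, hHG z hz, smul_smul, pow_succ']

lemma HasStemFactorization.linStem_mul {H : ℂ → ℍ[ℂ]} {m : ℕ} {qs : List ℍ[ℝ]} {J : ℍ[ℝ]}
    (hH : HasStemFactorization D H z₀ m qs) (hz₀ : z₀ ∈ D) (him : 0 ≤ z₀.im) (hJ : J ∈ imagUnits)
    (hFH : ∀ z ∈ D, F z = linStem (slicePoint J z₀) z * H z) (h0 : F z₀ ≠ 0) :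
    HasStemFactorization D F z₀ m (slicePoint J z₀ :: qs) := by
  obtain ⟨hqs, hc, G, hG, hG0, hHG⟩ := hH
  have hFG (z : ℂ) (hz : z ∈ D) :
      F z = quad z₀ z ^ m • (linProd (slicePoint J z₀ :: qs) z * G z) := by
    rw [hFH z hz, hHG z hz, mul_smul_comm, linProd_cons_mul]
  refine ⟨List.forall_mem_cons.2 ⟨⟨J, hJ, rfl⟩, hqs⟩,
    List.isChain_cons.2 ⟨fun p hp hstar => h0 ?_, hc⟩, G, hG, hG0, hFG⟩
  obtain ⟨ps, rfl⟩ := List.head?_eq_some_iff.1 hp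
  rw [hFG z₀ hz₀, linProd_cons_mul, linProd_cons_mul, ← star_star p, ← hstar,
    linStem_mul_linStem_star, planePoint_slicePoint hJ him, quad_self, zero_smul, smul_zero]

lemma IsRegularStem.exists_hasStemFactorization (hF : IsRegularStem D F) (hD : IsOpen D)
    (hsymm : ∀ z ∈ D, star z ∈ D) (hz₀ : z₀ ∈ D) (him : 0 < z₀.im)
    (hord : analyticOrderAt (fun z => Quaternion.normSq (F z)) z₀ ≠ ⊤) :
    ∃ m qs, HasStemFactorization D F z₀ m qs := by
  have hDz₀ := hD.mem_nhds hz₀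
  have hquad : AnalyticAt ℂ (quad z₀) z₀ := by unfold quad; fun_prop
  induction hk : analyticOrderAt (fun z => Quaternion.normSq (F z)) z₀
    using WellFoundedLT.induction generalizing F with
  | ind k ih =>
  subst hk
  have hlt {H : ℂ → ℍ[ℂ]} (hH : IsRegularStem D H) {χ : ℂ → ℂ} (hχ : AnalyticAt ℂ χ z₀)
      (hχ0 : χ z₀ = 0)
      (hFH : ∀ z ∈ D, Quaternion.normSq (F z) = χ z * Quaternion.normSq (H z)) :=
    analyticOrderAt_lt_of_eventuallyEq_mul hχ hχ0 (hH.2.normSq.analyticAt hDz₀)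
      (Filter.eventually_of_mem hDz₀ hFH) hord
  by_cases h0 : F z₀ = 0
  · obtain ⟨H, hH, hFH⟩ := hF.exists_eq_quad_smul hD hsymm hz₀ him.ne' h0
    have hltH := hlt hH (hquad.pow 2) (by simp) fun z hz => by
      rw [hFH z hz, Quaternion.normSq_smul, Pi.pow_apply]
    obtain ⟨m, qs, h⟩ := ih _ hltH hH hltH.ne_top rfl
    exact ⟨m + 1, qs, h.quad_smul hFH⟩
  by_cases hzero : ∃ J ∈ imagUnits, evalAt J (F z₀) = 0
  · obtain ⟨J, hJ, hJ0⟩ := hzero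
    obtain ⟨H, hH, hFH⟩ := hF.exists_eq_linStem_mul hD hsymm hz₀ him hJ hJ0
    have hltH := hlt hH hquad (quad_self z₀) fun z hz => by
      rw [hFH z hz, map_mul, normSq_linStem, planePoint_slicePoint hJ him.le]
    obtain ⟨m, qs, h⟩ := ih _ hltH hH hltH.ne_top rfl
    exact ⟨m, _, h.linStem_mul hz₀ him.le hJ hFH h0⟩
  · push Not at hzero
    refine ⟨0, [], by simp, .nil, F, hF, hzero, fun z _ => ?_⟩
    rw [pow_zero, one_smul, linProd_nil, one_mul]

end Factorization

section SqDeriv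

variable {V : Type*} [NormedAddCommGroup V] [NormedSpace ℝ V]

/-- The operator `-(2t)⁻¹ d/dt`, which is `-d/ds` in the variable `s = t²`. -/
def sqDeriv (g : ℝ → V) (t : ℝ) : V := -(2 * t)⁻¹ • deriv g t

lemma sqDeriv_congr {g h : ℝ → V} {b : ℝ} (e : g =ᶠ[𝓝 b] h) : sqDeriv g =ᶠ[𝓝 b] sqDeriv h := by
  filter_upwards [e.deriv] with t ht
  rw [sqDeriv, ht, sqDeriv]

lemma sqDeriv_sq_sub_sq_pow_smul {b t : ℝ} (ht : t ≠ 0) {r : ℝ → V} (hr : DifferentiableAt ℝ r t)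
    (i : ℕ) : sqDeriv (fun t => (b ^ 2 - t ^ 2) ^ (i + 1) • r t) t =
      (b ^ 2 - t ^ 2) ^ i • ((i + 1 : ℝ) • r t + (b ^ 2 - t ^ 2) • sqDeriv r t) := by
  have hsq : HasDerivAt (fun t : ℝ => b ^ 2 - t ^ 2) (-(2 * t)) t := by
    simpa using (hasDerivAt_pow 2 t).const_sub (b ^ 2)
  have hmul := ((hsq.fun_pow (i + 1)).fun_smul hr.hasDerivAt).deriv
  rw [sqDeriv, hmul, sqDeriv, Nat.add_sub_cancel]
  match_scalars
  · ring
  · field_simp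

variable [CompleteSpace V]

lemma exists_iterate_sqDeriv_eventuallyEq {b : ℝ} (hb : b ≠ 0) {g p : ℝ → V} {m : ℕ}
    (hp : AnalyticAt ℝ p b) (hg : g =ᶠ[𝓝 b] fun t => (b ^ 2 - t ^ 2) ^ m • p t) {j : ℕ}
    (hj : j ≤ m) : ∃ r : ℝ → V, AnalyticAt ℝ r b ∧ r b = (m.descFactorial j : ℝ) • p b ∧
      sqDeriv^[j] g =ᶠ[𝓝 b] fun t => (b ^ 2 - t ^ 2) ^ (m - j) • r t := by
  induction j with
  | zero => exact ⟨p, hp, by simp, by simpa using hg⟩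
  | succ j ih =>
    obtain ⟨r, hr, hrb, hrg⟩ := ih (by omega)
    obtain ⟨i, hi⟩ : ∃ i, m - j = i + 1 := ⟨m - j - 1, by omega⟩
    refine ⟨fun t => (i + 1 : ℝ) • r t + (b ^ 2 - t ^ 2) • sqDeriv r t, ?_, ?_, ?_⟩
    · have hinv : AnalyticAt ℝ (fun t : ℝ => (2 * t)⁻¹) b :=
        AnalyticAt.inv (by fun_prop) (by simpa using hb)
      have _ := hr.deriv
      unfold sqDeriv
      fun_prop
    · simp only [sub_self, zero_smul, add_zero, hrb, smul_smul, Nat.descFactorial_succ, hi]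
      push_cast
      rfl
    · rw [Function.iterate_succ_apply', show m - (j + 1) = i by omega]
      refine (sqDeriv_congr hrg).trans ?_
      filter_upwards [hr.eventually_analyticAt, eventually_ne_nhds hb] with t hrt ht
      rw [hi, sqDeriv_sq_sub_sq_pow_smul ht hrt.differentiableAt]

end SqDeriv

section ImSqDeriv

variable {V : Type*} [NormedAddCommGroup V] [NormedSpace ℝ V] {u v : ℂ → V} {z : ℂ}

/-- The operator `-(2β)⁻¹ ∂/∂β` on functions of `z = α + i β`. -/
def imSqDeriv (u : ℂ → V) (z : ℂ) : V := sqDeriv (fun t => u ⟨z.re, t⟩) z.im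

lemma iterate_imSqDeriv_eq (u : ℂ → V) (k : ℕ) (z : ℂ) :
    imSqDeriv^[k] u z = sqDeriv^[k] (fun t => u ⟨z.re, t⟩) z.im := by
  induction k generalizing z with
  | zero => rfl
  | succ k ih => simp only [Function.iterate_succ_apply', imSqDeriv, ih]

lemma hasDerivAt_vertical (a t : ℝ) : HasDerivAt (fun s : ℝ => (⟨a, s⟩ : ℂ)) Complex.I t := by
  simp only [Complex.mk_eq_add_mul_I]
  simpa using ((Complex.ofRealCLM.hasDerivAt (x := t)).mul_const Complex.I).const_add (a : ℂ)

lemma analyticAt_vertical (a t : ℝ) : AnalyticAt ℝ (fun s : ℝ => (⟨a, s⟩ : ℂ)) t := by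
  simp only [Complex.mk_eq_add_mul_I]
  exact analyticAt_const.add ((Complex.ofRealCLM.analyticAt t).mul analyticAt_const)

lemma imSqDeriv_eq_smul_fderiv (hu : DifferentiableAt ℝ u z) :
    imSqDeriv u z = -(2 * z.im)⁻¹ • fderiv ℝ u z Complex.I := by
  rw [imSqDeriv, sqDeriv]
  congr 1
  exact (hu.hasFDerivAt.comp_hasDerivAt z.im (hasDerivAt_vertical z.re z.im)).deriv

lemma imSqDeriv_congr (h : u =ᶠ[𝓝 z] v) : imSqDeriv u z = imSqDeriv v z := by
  have hline := (analyticAt_vertical z.re z.im).continuousAt.eventually h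
  exact (sqDeriv_congr hline).eq_of_nhds

lemma fderiv_inv_im_smul_one (hz : z.im ≠ 0) (hu : DifferentiableAt ℝ u z) :
    fderiv ℝ (fun w => w.im⁻¹ • u w) z 1 = z.im⁻¹ • fderiv ℝ u z 1 := by
  have hinv : HasFDerivAt (fun w : ℂ => w.im⁻¹) _ z :=
    (hasDerivAt_inv hz).comp_hasFDerivAt z Complex.imCLM.hasFDerivAt
  rw [(hinv.fun_smul hu.hasFDerivAt).fderiv]
  simp

variable [CompleteSpace V]

lemma analyticAt_fderiv_apply (hu : AnalyticAt ℝ u z) (w : ℂ) :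
    AnalyticAt ℝ (fun z => fderiv ℝ u z w) z :=
  ((ContinuousLinearMap.apply ℝ V w).analyticAt _).comp hu.fderiv

lemma analyticAt_inv_im (hz : z.im ≠ 0) : AnalyticAt ℝ (fun w : ℂ => w.im⁻¹) z :=
  (Complex.imCLM.analyticAt z).inv hz

lemma imSqDeriv_eventuallyEq (hu : AnalyticAt ℝ u z) :
    imSqDeriv u =ᶠ[𝓝 z] fun w => w.im⁻¹ • (-(1 / 2) : ℝ) • fderiv ℝ u w Complex.I := by
  filter_upwards [hu.eventually_analyticAt] with w hw
  rw [imSqDeriv_eq_smul_fderiv hw.differentiableAt, smul_smul, mul_inv]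
  ring_nf

lemma analyticAt_imSqDeriv (hz : z.im ≠ 0) (hu : AnalyticAt ℝ u z) :
    AnalyticAt ℝ (imSqDeriv u) z :=
  ((analyticAt_inv_im hz).smul (analyticAt_const.smul (analyticAt_fderiv_apply hu _))).congr
    (imSqDeriv_eventuallyEq hu).symm

lemma analyticAt_iterate_imSqDeriv (hz : z.im ≠ 0) (hu : AnalyticAt ℝ u z) (k : ℕ) :
    AnalyticAt ℝ (imSqDeriv^[k] u) z := by
  induction k with
  | zero => exact hu
  | succ k ih =>
    rw [Function.iterate_succ_apply']
    exact analyticAt_imSqDeriv hz ih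

lemma fderiv_fderiv_apply (hu : AnalyticAt ℝ u z) (w w' : ℂ) :
    fderiv ℝ (fun z => fderiv ℝ u z w) z w' = fderiv ℝ (fderiv ℝ u) z w' w := by
  rw [fderiv_clm_apply hu.fderiv.differentiableAt (differentiableAt_const w)]
  simp

lemma imSqDeriv_smul_fderiv_one (hz : z.im ≠ 0) (hu : AnalyticAt ℝ u z) (c : ℝ) :
    imSqDeriv (fun w => c • fderiv ℝ u w 1) z = c • fderiv ℝ (imSqDeriv u) z 1 := by
  have hd (w : ℂ) : DifferentiableAt ℝ (fun z => fderiv ℝ u z w) z :=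
    (analyticAt_fderiv_apply hu w).differentiableAt
  have hsymm : fderiv ℝ (fderiv ℝ u) z Complex.I 1 = fderiv ℝ (fderiv ℝ u) z 1 Complex.I :=
    (hu.contDiffAt (n := 2)).isSymmSndFDerivAt (by simp) _ _
  rw [(imSqDeriv_eventuallyEq hu).fderiv_eq, fderiv_inv_im_smul_one hz ((hd _).fun_const_smul _),
    imSqDeriv_eq_smul_fderiv ((hd 1).fun_const_smul c), fderiv_fun_const_smul (hd _),
    fderiv_fun_const_smul (hd _)]
  simp only [smul_apply, fderiv_fderiv_apply hu, hsymm]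
  match_scalars
  field_simp

lemma iterate_imSqDeriv_smul_fderiv_one (hz : z.im ≠ 0) (hu : AnalyticAt ℝ u z) {c : ℝ}
    (h : v =ᶠ[𝓝 z] fun w => c • fderiv ℝ u w 1) (k : ℕ) :
    imSqDeriv^[k] v =ᶠ[𝓝 z] fun w => c • fderiv ℝ (imSqDeriv^[k] u) w 1 := by
  induction k with
  | zero => exact h
  | succ k ih =>
    have hne : ∀ᶠ w in 𝓝 z, w.im ≠ 0 := Complex.continuous_im.continuousAt.eventually_ne hz
    filter_upwards [ih.eventually_nhds, hne, hu.eventually_analyticAt] with w hw hw_im huw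
    rw [Function.iterate_succ_apply', Function.iterate_succ_apply', imSqDeriv_congr hw,
      imSqDeriv_smul_fderiv_one hw_im (analyticAt_iterate_imSqDeriv hw_im huw k)]

end ImSqDeriv

section Bridge

variable {D : Set ℂ} {F G : ℂ → ℍ[ℂ]} {f g : ℍ[ℝ] → ℍ[ℝ]}

lemma stemOf_eq_ofParts {z : ℂ} {x y : ℍ[ℝ]}
    (h : ∀ J ∈ imagUnits, f (slicePoint J z) = x + J * y) : stemOf f z = ofParts x y := by
  rw [stemOf, h _ unitI_mem_imagUnits, h _ (neg_mem_imagUnits unitI_mem_imagUnits)]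
  congr 1
  · rw [neg_mul]
    module
  · have hdiff : x + unitI * y - (x + -unitI * y) = (2 : ℝ) • (unitI * y) := by
      rw [neg_mul]
      module
    rw [hdiff, smul_smul, mul_smul_comm, neg_mul, mul_mul_of_mem_imagUnits unitI_mem_imagUnits]
    norm_num

lemma IsInducedBy.stemOf_eq (hf : IsInducedBy D F f) {z : ℂ} (hz : z ∈ D) : stemOf f z = F z :=
  stemOf_eq_ofParts (hf z hz)

lemma induce_slicePoint {J : ℍ[ℝ]} (hJ : J ∈ imagUnits) (F : ℂ → ℍ[ℂ]) {z : ℂ} (hz : 0 < z.im) :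
    induce F (slicePoint J z) = evalAt J (F z) := by
  have hp : (⟨(slicePoint J z).re, ‖(slicePoint J z).im‖⟩ : ℂ) = z :=
    planePoint_slicePoint hJ hz.le
  rw [induce, hp, norm_im_slicePoint hJ, abs_of_pos hz, im_slicePoint hJ, smul_smul,
    inv_mul_cancel₀ hz.ne', one_smul, evalAt]

lemma IsStem.part1_eq_zero (hF : IsStem D F) {z : ℂ} (hz : z ∈ D) (him : z.im = 0) :
    part1 (F z) = 0 := by
  have : IsAddTorsionFree ℍ[ℝ] := .of_module_rat ℍ[ℝ]
  have hneg : part1 (F z) = -part1 (F z) := by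
    simpa only [Complex.star_def, Complex.conj_eq_iff_im.2 him, part1_ofParts]
      using congrArg part1 (hF z hz)
  exact self_eq_neg.1 hneg

lemma IsStem.isInducedBy_induce (hF : IsStem D F) : IsInducedBy D F (induce F) := by
  intro z hz J hJ
  rcases lt_trichotomy z.im 0 with him | him | him
  · have hpt : slicePoint J z = slicePoint (-J) (star z) := by rw [slicePoint_star, neg_neg]
    rw [hpt, induce_slicePoint (neg_mem_imagUnits hJ) _ (by simpa using him), hF z hz, evalAt,
      part0_ofParts, part1_ofParts, neg_mul_neg]
  · have hp : (⟨(slicePoint J z).re, ‖(slicePoint J z).im‖⟩ : ℂ) = z :=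
      planePoint_slicePoint hJ him.ge
    rw [induce, hp, hF.part1_eq_zero hz him, mul_zero, mul_zero]
  · exact induce_slicePoint hJ F him

lemma IsInducedBy.sliceMul (hsymm : ∀ z ∈ D, star z ∈ D) (hFG : IsStem D fun z => F z * G z)
    (hf : IsInducedBy D F f) (hg : IsInducedBy D G g) :
    IsInducedBy D (fun z => F z * G z) (sliceMul f g) := by
  have hstem (z : ℂ) (hz : z ∈ D) : stemOf f z * stemOf g z = F z * G z := by
    rw [hf.stemOf_eq hz, hg.stemOf_eq hz]
  have hstem' : IsStem D fun z => stemOf f z * stemOf g z := fun z hz => by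
    simpa only [hstem z hz, hstem _ (hsymm z hz)] using hFG z hz
  exact fun z hz J hJ => (hstem'.isInducedBy_induce z hz J hJ).trans (by simp only [hstem z hz])

lemma isInducedBy_sub (D : Set ℂ) (q : ℍ[ℝ]) : IsInducedBy D (linStem q) (fun x => x - q) := by
  intro z _ J _
  simp only [slicePoint, linStem, part0_ofParts, part1_ofParts, add_sub_right_comm]

lemma IsInducedBy.linearFactors (hsymm : ∀ z ∈ D, star z ∈ D) (hG : IsRegularStem D G)
    (hg : IsInducedBy D G g) (qs : List ℍ[ℝ]) :
    IsInducedBy D (fun z => linProd qs z * G z) (linearFactors qs g) := by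
  induction qs with
  | nil => simpa only [linProd_nil, one_mul, SliceAnalysis.linearFactors, List.foldr_nil] using hg
  | cons q qs ih =>
    simp only [linProd_cons_mul]
    exact .sliceMul hsymm ((isRegularStem_linStem D q).mul (hG.linProd_mul qs)).1
      (isInducedBy_sub D q) ih

lemma IsInducedBy.charPoly_pow_mul (hf : IsInducedBy D F f) (q : ℍ[ℝ]) (m : ℕ) :
    IsInducedBy D (fun z => quad (planePoint q) z ^ m • F z) (fun x => charPoly q x ^ m * f x) := by
  intro z hz J hJ
  change charPoly q (slicePoint J z) ^ m * f (slicePoint J z) = evalAt J (_ • F z)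
  rw [charPoly_slicePoint hJ, evalAt_smul hJ, hf z hz J hJ, slicePoint_eq_lift hJ,
    slicePoint_eq_lift hJ, map_pow]
  rfl

lemma hasFactorization_iff (hsymm : ∀ z ∈ D, star z ∈ D) (hf : IsInducedBy D F f) {q : ℍ[ℝ]}
    (hq : planePoint q ∈ D) {m : ℕ} {qs : List ℍ[ℝ]} :
    HasFactorization D f q m qs ↔ HasStemFactorization D F (planePoint q) m qs := by
  refine and_congr Iff.rfl (and_congr Iff.rfl ⟨?_, ?_⟩)
  · rintro ⟨g, ⟨G, hGs, hGh, hg⟩, hg0, hfg⟩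
    refine ⟨G, ⟨hGs, hGh⟩, fun J hJ h => hg0 _ ⟨J, hJ, rfl⟩ ((hg _ hq J hJ).trans h),
      fun z hz => ext_evalAt fun J hJ => ?_⟩
    rw [evalAt, ← hf z hz J hJ, hfg _ ⟨z, hz, J, hJ, rfl⟩]
    exact (hg.linearFactors hsymm ⟨hGs, hGh⟩ qs).charPoly_pow_mul q m z hz J hJ
  · rintro ⟨G, hG, hG0, hFG⟩
    have hg := hG.1.isInducedBy_induce
    refine ⟨induce G, ⟨G, hG.1, hG.2, hg⟩, ?_, ?_⟩
    · rintro x ⟨J, hJ, rfl⟩ h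
      exact hG0 J hJ ((hg _ hq J hJ).symm.trans h)
    · rintro x ⟨z, hz, J, hJ, rfl⟩
      rw [hf z hz J hJ, hFG z hz]
      exact ((hg.linearFactors hsymm hG qs).charPoly_pow_mul q m z hz J hJ).symm

end Bridge

section SliceDerivative

variable {z : ℂ}

lemma wirtinger_clm_comp {F : ℂ → ℍ[ℂ]} (hF : DifferentiableAt ℝ F z) (L : ℍ[ℂ] →L[ℂ] ℂ) :
    wirtinger (fun w => L (F w)) z =
      L ((1 / 2 : ℂ) • (fderiv ℝ F z 1 - Complex.I • fderiv ℝ F z Complex.I)) := by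
  have hL : HasFDerivAt (fun w => L (F w)) _ z :=
    (L.restrictScalars ℝ).hasFDerivAt.comp z hF.hasFDerivAt
  rw [wirtinger, hL.fderiv]
  simp

lemma stemDeriv_eq {F : ℂ → ℍ[ℂ]} (hF : DifferentiableAt ℝ F z) :
    stemDeriv F z = (1 / 2 : ℂ) • (fderiv ℝ F z 1 - Complex.I • fderiv ℝ F z Complex.I) := by
  have h (i : Fin 4) := wirtinger_clm_comp hF
    ((ContinuousLinearMap.proj i).comp (coords.toContinuousLinearEquiv : ℍ[ℂ] →L[ℂ] Fin 4 → ℂ))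
  exact Quaternion.ext _ _ (h 0) (h 1) (h 2) (h 3)

lemma stemDeriv_congr {F G : ℂ → ℍ[ℂ]} (h : F =ᶠ[𝓝 z] G) : stemDeriv F z = stemDeriv G z := by
  have hcomp (φ : ℍ[ℂ] → ℂ) :
      wirtinger (fun w => φ (F w)) z = wirtinger (fun w => φ (G w)) z := by
    have hφ : (fun w => φ (F w)) =ᶠ[𝓝 z] fun w => φ (G w) := h.fun_comp φ
    rw [wirtinger, wirtinger, hφ.fderiv_eq]
  exact Quaternion.ext _ _ (hcomp (·.re)) (hcomp (·.imI)) (hcomp (·.imJ)) (hcomp (·.imK))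

lemma stemDeriv_ofParts_zero {s : ℂ → ℍ[ℝ]} (hs : DifferentiableAt ℝ s z) (hz : z.im ≠ 0) :
    stemDeriv (fun w => ofParts (s w) 0) z =
      ofParts ((1 / 2 : ℝ) • fderiv ℝ s z 1) (z.im • imSqDeriv s z) := by
  have hF : HasFDerivAt (fun w => ofParts (s w) 0) _ z :=
    parts.symm.hasFDerivAt.comp z (hs.hasFDerivAt.prodMk (hasFDerivAt_const 0 z))
  rw [stemDeriv_eq hF.differentiableAt, hF.fderiv, imSqDeriv_eq_smul_fderiv hs]
  change (1 / 2 : ℂ) • (ofParts (fderiv ℝ s z 1) 0 -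
    Complex.I • ofParts (fderiv ℝ s z Complex.I) 0) = _
  apply ext_part <;> ext <;> simp [field]

lemma sphericalDeriv_slicePoint {h : ℍ[ℝ] → ℍ[ℝ]} {a s : ℍ[ℝ]} (hz : z.im ≠ 0)
    (hh : ∀ J ∈ imagUnits, h (slicePoint J z) = a + J * (z.im • s)) {J : ℍ[ℝ]}
    (hJ : J ∈ imagUnits) : sphericalDeriv h (slicePoint J z) = s := by
  have hJ0 : J ≠ 0 := ne_zero_of_norm_ne_zero (by simp [norm_eq_one_of_mem_imagUnits hJ])
  have hne : 2 * (z.im • J) ≠ 0 := by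
    rw [two_mul, ← two_smul ℝ]
    exact smul_ne_zero two_ne_zero (smul_ne_zero hz hJ0)
  have hdiff : a + J * (z.im • s) - (a + -J * (z.im • s)) = 2 * (z.im • J) * s := by
    rw [neg_mul, two_mul, add_mul, mul_smul_comm, smul_mul_assoc]
    abel
  rw [sphericalDeriv, im_slicePoint hJ, star_slicePoint hJ, hh J hJ,
    hh _ (neg_mem_imagUnits hJ), hdiff, inv_mul_cancel_left₀ hne]

lemma sliceDeriv_sphericalDeriv_slicePoint {h : ℍ[ℝ] → ℍ[ℝ]} {a s : ℂ → ℍ[ℝ]} (hz : 0 < z.im)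
    (hh : ∀ᶠ w in 𝓝 z, ∀ J ∈ imagUnits, h (slicePoint J w) = a w + J * (w.im • s w))
    (hs : DifferentiableAt ℝ s z) {J : ℍ[ℝ]} (hJ : J ∈ imagUnits) :
    sliceDeriv (sphericalDeriv h) (slicePoint J z) =
      (1 / 2 : ℝ) • fderiv ℝ s z 1 + J * (z.im • imSqDeriv s z) := by
  have hne : ∀ᶠ w in 𝓝 z, w.im ≠ 0 := Complex.continuous_im.continuousAt.eventually_ne hz.ne'
  have hstem : stemOf (sphericalDeriv h) =ᶠ[𝓝 z] fun w => ofParts (s w) 0 := by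
    filter_upwards [hh, hne] with w hw hw_im
    refine stemOf_eq_ofParts fun J hJ => ?_
    rw [sphericalDeriv_slicePoint hw_im hw hJ, mul_zero, add_zero]
  rw [sliceDeriv, induce_slicePoint hJ _ hz, stemDeriv_congr hstem,
    stemDeriv_ofParts_zero hs hz.ne', evalAt, part0_ofParts, part1_ofParts]

end SliceDerivative

section SliceDerivativeIterates

variable {D : Set ℂ} {F P : ℂ → ℍ[ℂ]} {f : ℍ[ℝ] → ℍ[ℝ]} {z : ℂ}

/-- The stem function `F₁ / Im z` of the spherical derivative of `𝓘 F`; it takes values in the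
real part `ℍ` of `ℍ ⊗ ℂ`. -/
def stemSlope (F : ℂ → ℍ[ℂ]) (z : ℂ) : ℍ[ℝ] := z.im⁻¹ • part1 (F z)

lemma evalAt_eq_part0_add_smul_stemSlope (hz : z.im ≠ 0) (F : ℂ → ℍ[ℂ]) (J : ℍ[ℝ]) :
    evalAt J (F z) = part0 (F z) + J * (z.im • stemSlope F z) := by
  rw [stemSlope, smul_inv_smul₀ hz, evalAt]

lemma analyticAt_part0 (hF : AnalyticAt ℝ F z) : AnalyticAt ℝ (fun w => part0 (F w)) z :=
  analyticAt_fst.comp ((parts.toContinuousLinearMap.analyticAt (F z)).comp hF)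

lemma analyticAt_part1 (hF : AnalyticAt ℝ F z) : AnalyticAt ℝ (fun w => part1 (F w)) z :=
  analyticAt_snd.comp ((parts.toContinuousLinearMap.analyticAt (F z)).comp hF)

lemma analyticAt_stemSlope (hF : AnalyticAt ℝ F z) (hz : z.im ≠ 0) :
    AnalyticAt ℝ (stemSlope F) z :=
  (analyticAt_inv_im hz).smul (analyticAt_part1 hF)

lemma hasFDerivAt_parts (hF : DifferentiableAt ℂ F z) :
    HasFDerivAt (fun w => parts (F w)) ((parts : ℍ[ℂ] →L[ℝ] ℍ[ℝ] × ℍ[ℝ]).comp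
      ((ContinuousLinearMap.toSpanSingleton ℂ (deriv F z)).restrictScalars ℝ)) z :=
  parts.hasFDerivAt.comp z (hF.hasDerivAt.hasFDerivAt.restrictScalars ℝ)

lemma imSqDeriv_part0 (hF : DifferentiableAt ℂ F z) (hz : z.im ≠ 0) :
    imSqDeriv (fun w => part0 (F w)) z = (1 / 2 : ℝ) • fderiv ℝ (stemSlope F) z 1 := by
  have h0 : HasFDerivAt (fun w => part0 (F w)) _ z := (hasFDerivAt_parts hF).fst
  have h1 : HasFDerivAt (fun w => part1 (F w)) _ z := (hasFDerivAt_parts hF).snd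
  have hreal : fderiv ℝ (fun w => part1 (F w)) z 1 = part1 (deriv F z) := by
    rw [h1.fderiv]
    exact congrArg part1 (one_smul ℂ (deriv F z))
  have himag : fderiv ℝ (fun w => part0 (F w)) z Complex.I = -part1 (deriv F z) := by
    rw [h0.fderiv]
    refine (part0_smul Complex.I (deriv F z)).trans ?_
    rw [Complex.I_re, Complex.I_im, zero_smul, one_smul, zero_sub]
  have hslope : fderiv ℝ (stemSlope F) z 1 = z.im⁻¹ • part1 (deriv F z) :=
    (fderiv_inv_im_smul_one hz h1.differentiableAt).trans (by rw [hreal])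
  rw [imSqDeriv_eq_smul_fderiv h0.differentiableAt, himag, hslope, smul_neg, neg_smul, neg_neg,
    smul_smul, mul_inv, one_div]

lemma csDeriv_succ (k : ℕ) (f : ℍ[ℝ] → ℍ[ℝ]) :
    csDeriv (k + 1) f = sliceDeriv (sphericalDeriv (csDeriv k f)) :=
  Function.iterate_succ_apply' _ k f

lemma csDeriv_slicePoint (hD : IsOpen D) (hF : DifferentiableOn ℂ F D)
    (hf : IsInducedBy D F f) (k : ℕ) (hz : z ∈ D) (him : 0 < z.im) {J : ℍ[ℝ]}
    (hJ : J ∈ imagUnits) :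
    csDeriv k f (slicePoint J z) =
      imSqDeriv^[k] (fun w => part0 (F w)) z + J * (z.im • imSqDeriv^[k] (stemSlope F) z) := by
  induction k generalizing z J with
  | zero => exact (hf z hz J hJ).trans (evalAt_eq_part0_add_smul_stemSlope him.ne' F J)
  | succ k ih =>
    have hupper : ∀ᶠ w in 𝓝 z, w ∈ D ∧ 0 < w.im :=
      (hD.eventually_mem hz).and (Complex.continuous_im.continuousAt.eventually (lt_mem_nhds him))
    have hslope := analyticAt_stemSlope
      ((hF.analyticAt (hD.mem_nhds hz)).restrictScalars (𝕜 := ℝ)) him.ne'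
    have hcauchyRiemann : imSqDeriv (fun w => part0 (F w)) =ᶠ[𝓝 z] fun w =>
        (1 / 2 : ℝ) • fderiv ℝ (stemSlope F) w 1 := by
      filter_upwards [hupper] with w hw
      exact imSqDeriv_part0 (hF.differentiableAt (hD.mem_nhds hw.1)) hw.2.ne'
    rw [csDeriv_succ, sliceDeriv_sphericalDeriv_slicePoint him
      (hupper.mono fun w hw K hK => ih hw.1 hw.2 hK)
      (analyticAt_iterate_imSqDeriv him.ne' hslope k).differentiableAt hJ,
      Function.iterate_succ_apply, Function.iterate_succ_apply',
      (iterate_imSqDeriv_smul_fderiv_one him.ne' hslope hcauchyRiemann k).eq_of_nhds]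

lemma sphericalDeriv_csDeriv_slicePoint (hD : IsOpen D) (hF : DifferentiableOn ℂ F D)
    (hf : IsInducedBy D F f) (k : ℕ) (hz : z ∈ D) (him : 0 < z.im) {J : ℍ[ℝ]}
    (hJ : J ∈ imagUnits) :
    sphericalDeriv (csDeriv k f) (slicePoint J z) = imSqDeriv^[k] (stemSlope F) z :=
  sphericalDeriv_slicePoint him.ne' (fun _ hK => csDeriv_slicePoint hD hF hf k hz him hK) hJ

end SliceDerivativeIterates

section LeadingDerivative

variable {V : Type*} [NormedAddCommGroup V] [NormedSpace ℝ V] [CompleteSpace V] {z : ℂ}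
  {u p : ℂ → V} {m : ℕ}

lemma iterate_imSqDeriv_eq_zero (hz : z.im ≠ 0) (hp : AnalyticAt ℝ p z)
    (hu : ∀ᶠ t in 𝓝 z.im, u ⟨z.re, t⟩ = (z.im ^ 2 - t ^ 2) ^ m • p ⟨z.re, t⟩) {k : ℕ}
    (hk : k < m) : imSqDeriv^[k] u z = 0 := by
  obtain ⟨r, -, -, hev⟩ := exists_iterate_sqDeriv_eventuallyEq hz
    (hp.comp (analyticAt_vertical z.re z.im)) hu hk.le
  rw [iterate_imSqDeriv_eq, hev.eq_of_nhds, sub_self, zero_pow (Nat.sub_ne_zero_of_lt hk),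
    zero_smul]

lemma iterate_imSqDeriv_eq_factorial_smul (hz : z.im ≠ 0) (hp : AnalyticAt ℝ p z)
    (hu : ∀ᶠ t in 𝓝 z.im, u ⟨z.re, t⟩ = (z.im ^ 2 - t ^ 2) ^ m • p ⟨z.re, t⟩) :
    imSqDeriv^[m] u z = (m.factorial : ℝ) • p z := by
  obtain ⟨r, -, hr, hev⟩ := exists_iterate_sqDeriv_eventuallyEq hz
    (hp.comp (analyticAt_vertical z.re z.im)) hu le_rfl
  rw [iterate_imSqDeriv_eq, hev.eq_of_nhds, hr, Nat.descFactorial_self, Nat.sub_self, pow_zero,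
    one_smul]
  rfl

end LeadingDerivative

section SphericalMultiplicity

variable {D : Set ℂ} {F P : ℂ → ℍ[ℂ]} {f : ℍ[ℝ] → ℍ[ℝ]} {z : ℂ} {m n : ℕ}

lemma eventually_vertical_eq (hD : IsOpen D) (hz : z ∈ D)
    (hFP : ∀ w ∈ D, F w = quad z w ^ m • P w) :
    ∀ᶠ t in 𝓝 z.im, F ⟨z.re, t⟩ = (z.im ^ 2 - t ^ 2) ^ m • P ⟨z.re, t⟩ := by
  filter_upwards [(analyticAt_vertical z.re z.im).continuousAt.eventually (hD.mem_nhds hz)]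
    with t ht
  rw [hFP _ ht, quad_vertical, ← Complex.ofReal_pow]
  exact Complex.coe_smul _ _

lemma eventually_part0_vertical_eq (hD : IsOpen D) (hz : z ∈ D)
    (hFP : ∀ w ∈ D, F w = quad z w ^ m • P w) :
    ∀ᶠ t in 𝓝 z.im,
      part0 (F ⟨z.re, t⟩) = (z.im ^ 2 - t ^ 2) ^ m • part0 (P ⟨z.re, t⟩) := by
  filter_upwards [eventually_vertical_eq hD hz hFP] with t ht
  exact congrArg Prod.fst ((congrArg parts ht).trans (map_smul parts _ _))

lemma eventually_stemSlope_vertical_eq (hD : IsOpen D) (hz : z ∈ D)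
    (hFP : ∀ w ∈ D, F w = quad z w ^ m • P w) :
    ∀ᶠ t in 𝓝 z.im,
      stemSlope F ⟨z.re, t⟩ = (z.im ^ 2 - t ^ 2) ^ m • stemSlope P ⟨z.re, t⟩ := by
  filter_upwards [eventually_vertical_eq hD hz hFP] with t ht
  have h1 : part1 (F ⟨z.re, t⟩) = (z.im ^ 2 - t ^ 2) ^ m • part1 (P ⟨z.re, t⟩) :=
    congrArg Prod.snd ((congrArg parts ht).trans (map_smul parts _ _))
  rw [stemSlope, stemSlope, h1, smul_comm]

lemma csDeriv_eq_zero_of_lt (hD : IsOpen D) (hF : DifferentiableOn ℂ F D)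
    (hP : DifferentiableOn ℂ P D) (hf : IsInducedBy D F f) (hz : z ∈ D) (him : 0 < z.im)
    (hFP : ∀ w ∈ D, F w = quad z w ^ m • P w) {J : ℍ[ℝ]} (hJ : J ∈ imagUnits) {k : ℕ}
    (hk : k < m) :
    csDeriv k f (slicePoint J z) = 0 ∧ sphericalDeriv (csDeriv k f) (slicePoint J z) = 0 := by
  have hPz := (hP.analyticAt (hD.mem_nhds hz)).restrictScalars (𝕜 := ℝ)
  have h0 := iterate_imSqDeriv_eq_zero (u := fun w => part0 (F w)) him.ne' (analyticAt_part0 hPz)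
    (eventually_part0_vertical_eq hD hz hFP) hk
  have h1 := iterate_imSqDeriv_eq_zero him.ne' (analyticAt_stemSlope hPz him.ne')
    (eventually_stemSlope_vertical_eq hD hz hFP) hk
  rw [csDeriv_slicePoint hD hF hf k hz him hJ,
    sphericalDeriv_csDeriv_slicePoint hD hF hf k hz him hJ, h0, h1, smul_zero, mul_zero, add_zero]
  exact ⟨rfl, rfl⟩

lemma csDeriv_eq_factorial_smul (hD : IsOpen D) (hF : DifferentiableOn ℂ F D)
    (hP : DifferentiableOn ℂ P D) (hf : IsInducedBy D F f) (hz : z ∈ D) (him : 0 < z.im)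
    (hFP : ∀ w ∈ D, F w = quad z w ^ m • P w) {J : ℍ[ℝ]} (hJ : J ∈ imagUnits) :
    csDeriv m f (slicePoint J z) = (m.factorial : ℝ) • evalAt J (P z) ∧
      sphericalDeriv (csDeriv m f) (slicePoint J z) = (m.factorial : ℝ) • stemSlope P z := by
  have hPz := (hP.analyticAt (hD.mem_nhds hz)).restrictScalars (𝕜 := ℝ)
  have h0 := iterate_imSqDeriv_eq_factorial_smul (u := fun w => part0 (F w)) him.ne'
    (analyticAt_part0 hPz) (eventually_part0_vertical_eq hD hz hFP)
  have h1 := iterate_imSqDeriv_eq_factorial_smul him.ne' (analyticAt_stemSlope hPz him.ne')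
    (eventually_stemSlope_vertical_eq hD hz hFP)
  rw [csDeriv_slicePoint hD hF hf m hz him hJ,
    sphericalDeriv_csDeriv_slicePoint hD hF hf m hz him hJ, h0, h1,
    evalAt_eq_part0_add_smul_stemSlope him.ne', smul_add, ← mul_smul_comm, smul_comm z.im]
  exact ⟨rfl, rfl⟩

lemma HasStemFactorization.eq_and_csDeriv_eq_zero_iff (hD : IsOpen D)
    (hF : DifferentiableOn ℂ F D) (hf : IsInducedBy D F f) (hz : z ∈ D) (him : 0 < z.im)
    {J : ℍ[ℝ]} (hJ : J ∈ imagUnits)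
    (hvanish : ∀ k < n, csDeriv k f (slicePoint J z) = 0 ∧
      sphericalDeriv (csDeriv k f) (slicePoint J z) = 0)
    (hne : csDeriv n f (slicePoint J z) ≠ 0 ∨
      sphericalDeriv (csDeriv n f) (slicePoint J z) ≠ 0) {qs : List ℍ[ℝ]}
    (h : HasStemFactorization D F z m qs) :
    m = n ∧ (csDeriv n f (slicePoint J z) = 0 ↔ qs.head? = some (slicePoint J z)) := by
  obtain ⟨hqs, hc, G, hG, hG0, hFG⟩ := h
  obtain ⟨hP0, hPz⟩ := linProd_mul_ne_zero_and_evalAt_eq_zero_iff him hG0 hqs hc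
  have hP := (hG.linProd_mul qs).differentiableOn
  have hfact : (m.factorial : ℝ) ≠ 0 := Nat.cast_ne_zero.2 m.factorial_ne_zero
  obtain ⟨hcs, hscs⟩ := csDeriv_eq_factorial_smul hD hF hP hf hz him hFG hJ
  obtain rfl : m = n := by
    rcases lt_trichotomy m n with hlt | heq | hgt
    · obtain ⟨hcs0, hscs0⟩ := hvanish m hlt
      rw [hcs, smul_eq_zero_iff_right hfact] at hcs0
      rw [hscs, smul_eq_zero_iff_right hfact, stemSlope,
        smul_eq_zero_iff_right (inv_ne_zero him.ne')] at hscs0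
      refine absurd (ext_part ?_ hscs0) hP0
      rwa [evalAt, hscs0, mul_zero, add_zero] at hcs0
    · exact heq
    · obtain ⟨hcs0, hscs0⟩ := csDeriv_eq_zero_of_lt hD hF hP hf hz him hFG hJ hgt
      exact (hne.elim (· hcs0) (· hscs0)).elim
  exact ⟨rfl, by rw [hcs, smul_eq_zero_iff_right hfact, hPz J hJ]⟩

lemma HasFactorization.eq_and_csDeriv_eq_zero_iff (hD : IsOpen D) (hsymm : ∀ z ∈ D, star z ∈ D)
    (hf : IsSliceRegular D f) {q : ℍ[ℝ]} (hq : q ∈ circularization D) (hq_im : q.im ≠ 0)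
    (hvanish : ∀ k < n, csDeriv k f q = 0 ∧ sphericalDeriv (csDeriv k f) q = 0)
    (hne : csDeriv n f q ≠ 0 ∨ sphericalDeriv (csDeriv n f) q ≠ 0) {qs : List ℍ[ℝ]}
    (h : HasFactorization D f q m qs) :
    m = n ∧ (csDeriv n f q = 0 ↔ qs.head? = some q) := by
  obtain ⟨F, -, hFh, hFf⟩ := hf
  have hF := isHolomorphicOn_iff_differentiableOn.1 hFh
  have hz := planePoint_mem hsymm hq
  have him : 0 < (planePoint q).im := norm_pos_iff.2 hq_im
  obtain ⟨J, hJ, hqJ⟩ := exists_eq_slicePoint_planePoint hq_im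
  have hstem := (hasFactorization_iff hsymm hFf hz).1 h
  have key := hstem.eq_and_csDeriv_eq_zero_iff (n := n) hD hF hFf hz him hJ
  rw [← hqJ] at key
  exact key hvanish hne

lemma IsRegularStem.eq_zero_of_eventually_normSq_eq_zero (hF : IsRegularStem D F) (hD : IsOpen D)
    (hconn : IsPreconnected D) {t : ℝ} (ht : (t : ℂ) ∈ D) (hz : z ∈ D)
    (h0 : ∀ᶠ w in 𝓝 z, Quaternion.normSq (F w) = 0) : ∀ w ∈ D, F w = 0 := by
  have hnormSq : ∀ w ∈ D, Quaternion.normSq (F w) = 0 := fun w hw =>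
    (hF.2.normSq.analyticOnNhd hD).eqOn_zero_of_preconnected_of_eventuallyEq_zero hconn hz h0 hw
  have hreal (s : ℝ) (hs : (s : ℂ) ∈ D) : F s = 0 := by
    have h1 := hF.1.part1_eq_zero hs (Complex.ofReal_im s)
    have hs0 := hnormSq s hs
    rw [normSq_eq, h1, map_zero, sub_zero, Complex.ext_iff] at hs0
    exact ext_part (Quaternion.normSq_eq_zero.1 hs0.1) h1
  have htend : Filter.Tendsto (fun s : ℝ => (s : ℂ)) (𝓝[≠] t) (𝓝[≠] (t : ℂ)) :=
    Complex.continuous_ofReal.continuousWithinAt.tendsto_nhdsWithin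
      fun s hs => by simpa using hs
  have hev : ∀ᶠ s : ℝ in 𝓝[≠] t, F s = 0 :=
    (Complex.continuous_ofReal.continuousWithinAt.eventually (hD.mem_nhds ht)).mono hreal
  exact (hF.differentiableOn.analyticOnNhd hD).eqOn_zero_of_preconnected_of_frequently_eq_zero
    hconn ht (htend.frequently hev.frequently)

lemma csDeriv_eq_zero_of_stem_eq_zero (hD : IsOpen D) (hf : IsInducedBy D F f)
    (hF : ∀ w ∈ D, F w = 0) (hz : z ∈ D) (him : 0 < z.im) {J : ℍ[ℝ]} (hJ : J ∈ imagUnits)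
    (k : ℕ) :
    csDeriv k f (slicePoint J z) = 0 ∧ sphericalDeriv (csDeriv k f) (slicePoint J z) = 0 := by
  have hF' : DifferentiableOn ℂ F D := (differentiableOn_const 0).congr hF
  exact csDeriv_eq_zero_of_lt hD hF' hF' hf hz him
    (fun w hw => by rw [hF w hw, smul_zero]) hJ k.lt_succ_self

lemma not_eventually_normSq_eq_zero (hD : IsOpen D) (hf : IsInducedBy D F f) {q : ℍ[ℝ]}
    (hq : planePoint q ∈ D) (h : ∃ᶠ x in 𝓝 q, ∀ y ∈ sphere x, f y ≠ 0) :
    ¬ ∀ᶠ w in 𝓝 (planePoint q), Quaternion.normSq (F w) = 0 := by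
  intro h0
  obtain ⟨x, hx, hx0, hxD⟩ := (h.and_eventually
    (continuous_planePoint.continuousAt.eventually (h0.and (hD.mem_nhds hq)))).exists
  obtain ⟨J, hJ, hJ0⟩ := exists_evalAt_eq_zero hx0
  exact hx _ ⟨J, hJ, rfl⟩ ((hf _ hxD J hJ).trans hJ0)

lemma IsSliceRegular.exists_hasFactorization (hD : IsOpen D) (hsymm : ∀ z ∈ D, star z ∈ D)
    (hf : IsSliceRegular D f) {q : ℍ[ℝ]} (hq : q ∈ circularization D) (hq_im : q.im ≠ 0)
    (hnd : (IsPreconnected D ∧ ∃ t : ℝ, (t : ℂ) ∈ D) ∨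
      ∃ᶠ x in 𝓝 q, ∀ y ∈ sphere x, f y ≠ 0)
    (hne : csDeriv n f q ≠ 0 ∨ sphericalDeriv (csDeriv n f) q ≠ 0) :
    ∃ m qs, HasFactorization D f q m qs := by
  obtain ⟨F, hFs, hFh, hFf⟩ := hf
  have hF : IsRegularStem D F := ⟨hFs, hFh⟩
  have hz := planePoint_mem hsymm hq
  have him : 0 < (planePoint q).im := norm_pos_iff.2 hq_im
  have hnormSq : ¬ ∀ᶠ w in 𝓝 (planePoint q), Quaternion.normSq (F w) = 0 := by
    rcases hnd with ⟨hconn, t, ht⟩ | hfreq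
    · intro h0
      obtain ⟨J, hJ, hqJ⟩ := exists_eq_slicePoint_planePoint hq_im
      have hF0 := hF.eq_zero_of_eventually_normSq_eq_zero hD hconn ht hz h0
      have hvanish := csDeriv_eq_zero_of_stem_eq_zero hD hFf hF0 hz him hJ n
      rw [← hqJ] at hvanish
      exact hne.elim (· hvanish.1) (· hvanish.2)
    · exact not_eventually_normSq_eq_zero hD hFf hz hfreq
  obtain ⟨m, qs, h⟩ :=
    hF.exists_hasStemFactorization hD hsymm hz him (mt analyticOrderAt_eq_top.1 hnormSq)
  exact ⟨m, qs, (hasFactorization_iff hsymm hFf hz).2 h⟩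

end SphericalMultiplicity

end SliceAnalysis

end

theorem corollary4p3 (D : Set ℂ) (hD : IsOpen D) (hsymm : ∀ z ∈ D, star z ∈ D)
    (f : ℍ[ℝ] → ℍ[ℝ]) (hf : SliceAnalysis.IsSliceRegular D f)
    (q₀ : ℍ[ℝ]) (hq₀ : q₀ ∈ SliceAnalysis.circularization D) (hq₀_im : q₀.im ≠ 0)
    -- either `Ω_D` is a slice domain, or `f` does not vanish on all the spheres around `𝕊_{q₀}`
    (hnd : (IsConnected D ∧ ∃ t : ℝ, (t : ℂ) ∈ D) ∨
      ∃ᶠ x in 𝓝 q₀, ∀ y ∈ SliceAnalysis.sphere x, f y ≠ 0)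
    (n : ℕ)
    (hvanish : ∀ k < n, SliceAnalysis.csDeriv k f q₀ = 0 ∧
      SliceAnalysis.sphericalDeriv (SliceAnalysis.csDeriv k f) q₀ = 0)
    (hne : SliceAnalysis.csDeriv n f q₀ ≠ 0 ∨
      SliceAnalysis.sphericalDeriv (SliceAnalysis.csDeriv n f) q₀ ≠ 0) :
    (∀ N : ℕ, SliceAnalysis.IsSphericalMultiplicity D f q₀ N ↔ N = 2 * n) ∧
    ((∃ r : ℕ, 0 < r ∧ SliceAnalysis.IsIsolatedMultiplicity D f q₀ r) ↔
      SliceAnalysis.csDeriv n f q₀ = 0) := by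
  open SliceAnalysis in
  obtain ⟨m, qs, h⟩ := hf.exists_hasFactorization hD hsymm hq₀ hq₀_im
    (hnd.imp_left fun hc => ⟨hc.1.isPreconnected, hc.2⟩) hne
  have hcrit {m' : ℕ} {ps : List ℍ[ℝ]} (h' : HasFactorization D f q₀ m' ps) :
      m' = n ∧ (csDeriv n f q₀ = 0 ↔ ps.head? = some q₀) :=
    h'.eq_and_csDeriv_eq_zero_iff hD hsymm hf hq₀ hq₀_im hvanish hne
  obtain ⟨rfl, hhead⟩ := hcrit h
  refine ⟨fun N => ⟨?_, ?_⟩, ?_, fun h0 => ?_⟩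
  · rintro ⟨m', ps, h', rfl⟩
    rw [(hcrit h').1]
  · rintro rfl
    exact ⟨m, qs, h, rfl⟩
  · rintro ⟨r, hr, m', ps, h', ⟨hq, -⟩ | ⟨-, rfl⟩⟩
    · exact (hcrit h').2.2 hq
    · exact absurd hr (lt_irrefl 0)
  · have hq := hhead.1 h0
    obtain ⟨ps, rfl⟩ := List.head?_eq_some_iff.1 hq
    exact ⟨_, List.length_pos_of_mem List.mem_cons_self, m, _, h, Or.inl ⟨hq, rfl⟩⟩
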